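/- Let $\mathcal H := \mathrm{conv}\{(x,xx^T,y,y_1y_2) : x\in\mathbb R^2,\ y\in\{0,1\}^2,\ 0\le x\le y\}\subset\mathbb R^2\times\mathbb S^2\times\mathbb R^2\times\mathbb R$, where $\mathbb S^2$ is the space of real symmetric $2\times2$ matrices, and write $(x,X,y,Y_{12})$ for points of this space. For $\alpha,\beta\in\mathbb R^2$ let $$M(\beta) := \begin{pmatrix} Y_{12} & (x-\alpha)^T\\ x-\alpha & X-\mathrm{Diag}(\beta)\end{pmatrix}\in\mathbb S^3,$$ and define, with the convention $0/0:=0$, $$\beta_{11} := (X_{11}-x_1+\alpha_1,\ X_{22}-x_2+\alpha_2),\qquad \beta_{21} := \left(\frac{\alpha_1^2}{y_1-Y_{12}},\ X_{22}-x_2+\alpha_2\right),$$ $$\beta_{12} := \left(X_{11}-x_1+\alpha_1,\ \frac{\alpha_2^2}{y_2-Y_{12}}\right),\qquad \beta_{22} := \left(\frac{\alpha_1^2}{y_1-Y_{12}},\ \frac{\alpha_2^2}{y_2-Y_{12}}\right).$$ Then $\mathcal H$ equals the projection onto $(x,X,y,Y_{12})$ of the set of all $(x,X,y,Y_{12},\alpha)\in\mathbb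 R^2\times\mathbb S^2\times\mathbb R^2\times\mathbb R\times\mathbb R^2$ satisfying the linear constraints 1. $\mathrm{diag}(X)\le x\le y$, 2. $\max\{0,\ x_1-\alpha_1+x_2-\alpha_2-Y_{12}\}\le X_{12}\le\min\{x_1-\alpha_1,\ x_2-\alpha_2\}$, 3. $0\le\alpha_j\le y_j-Y_{12}$ for $j=1,2$, 4. $\max\{0,\ y_1+y_2-1\}\le Y_{12}\le\min\{y_1,y_2\}$, and the four semidefinite constraints $M(\beta_{pq})\succeq0$ for $p,q\in\{1,2\}$. Moreover these constraints are convex: the set defined by the linear constraints 1–4 is convex, and for all $p,q\in\{1,2\}$ the set of points satisfying 1–4 and $M(\beta_{pq})\succeq0$ is convex. -/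

import Mathlib

namespace SwitchHull

/-- The space of points `(x, X, y, Y₁₂)`. The indices `1, 2` of the mathematics are `0, 1 : Fin 2`;
symmetry of `X` is imposed by the sets below. -/
abbrev Point : Type :=
  (Fin 2 → ℝ) × Matrix (Fin 2) (Fin 2) ℝ × (Fin 2 → ℝ) × ℝ

/-- The space of points `((x, X, y, Y₁₂), α)`; `Prod.fst` is the projection onto
`(x, X, y, Y₁₂)`. -/
abbrev Lifted : Type := Point × (Fin 2 → ℝ)

/-- `𝓗 = conv {(x, x xᵀ, y, y₁ y₂) : 0 ≤ x ≤ y ∈ {0, 1}²}`. -/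
def H : Set Point :=
  convexHull ℝ {v | ∃ x y : Fin 2 → ℝ, 0 ≤ x ∧ x ≤ y ∧ (∀ j, y j = 0 ∨ y j = 1) ∧
    v = (x, Matrix.vecMulVec x x, y, y 0 * y 1)}

/-- The polytope `RLT_y` in the space of `(y, Y₁₂)`. -/
def RLTy : Set ((Fin 2 → ℝ) × ℝ) :=
  {v | max 0 (v.1 0 + v.1 1 - 1) ≤ v.2 ∧ v.2 ≤ min (v.1 0) (v.1 1)}

/-- The symmetric block matrix `M(β)` with blocks `Y₁₂`, `x - α` and `X - Diag β`. -/
def M (x : Fin 2 → ℝ) (X : Matrix (Fin 2) (Fin 2) ℝ) (Y₁₂ : ℝ) (α β : Fin 2 → ℝ) :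
    Matrix (Fin 3) (Fin 3) ℝ :=
  !![Y₁₂,       x 0 - α 0,     x 1 - α 1;
     x 0 - α 0, X 0 0 - β 0,   X 0 1;
     x 1 - α 1, X 1 0,         X 1 1 - β 1]

/-- The first of the two candidates for the component `β_j`. -/
def affinePiece (x : Fin 2 → ℝ) (X : Matrix (Fin 2) (Fin 2) ℝ) (α : Fin 2 → ℝ) (j : Fin 2) : ℝ :=
  X j j - x j + α j

/-- The second of the two candidates for the component `β_j`, with `0 / 0 = 0`. -/
noncomputable def perspectivePiece (y : Fin 2 → ℝ) (Y₁₂ : ℝ) (α : Fin 2 → ℝ) (j : Fin 2) : ℝ :=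
  (y j - Y₁₂)⁻¹ * α j ^ 2

/-- `β_pq`: the label `p` selects the candidate for the first component and `q` that for the
second one. The labels `1, 2` of the mathematics are `0, 1 : Fin 2`. -/
noncomputable def betaPQ (p q : Fin 2) (x : Fin 2 → ℝ) (X : Matrix (Fin 2) (Fin 2) ℝ)
    (y : Fin 2 → ℝ) (Y₁₂ : ℝ) (α : Fin 2 → ℝ) : Fin 2 → ℝ :=
  ![if p = 0 then affinePiece x X α 0 else perspectivePiece y Y₁₂ α 0,
    if q = 0 then affinePiece x X α 1 else perspectivePiece y Y₁₂ α 1]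

/-- The points `(x, X, y, Y₁₂, α)` with `X` symmetric that satisfy the linear constraints. -/
def linearSet : Set Lifted :=
  {v | ∃ (x : Fin 2 → ℝ) (X : Matrix (Fin 2) (Fin 2) ℝ) (y : Fin 2 → ℝ) (Y₁₂ : ℝ) (α : Fin 2 → ℝ),
    v = ((x, X, y, Y₁₂), α) ∧
    X.IsSymm ∧
    (X.diag ≤ x ∧ x ≤ y) ∧
    (max 0 (x 0 - α 0 + (x 1 - α 1) - Y₁₂) ≤ X 0 1 ∧
      X 0 1 ≤ min (x 0 - α 0) (x 1 - α 1)) ∧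
    (∀ j, 0 ≤ α j ∧ α j ≤ y j - Y₁₂) ∧
    (y, Y₁₂) ∈ RLTy}

/-- The points `(x, X, y, Y₁₂, α)` that satisfy `M(β_pq) ⪰ 0`. -/
def psdSet (p q : Fin 2) : Set Lifted :=
  {v | ∃ (x : Fin 2 → ℝ) (X : Matrix (Fin 2) (Fin 2) ℝ) (y : Fin 2 → ℝ) (Y₁₂ : ℝ) (α : Fin 2 → ℝ),
    v = ((x, X, y, Y₁₂), α) ∧
    (M x X Y₁₂ α (betaPQ p q x X y Y₁₂ α)).PosSemidef}

/-- The points that satisfy the linear constraints and all four semidefinite constraints. -/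
def feasibleSet : Set Lifted :=
  {v | v ∈ linearSet ∧ ∀ p q : Fin 2, v ∈ psdSet p q}

end SwitchHull

/-! Think of a point of `H` as moments of a random pair `(x, y)`. The four values of `y` have masses
`Y`, `y 0 - Y`, `y 1 - Y` and `1 - y 0 - y 1 + Y`, and `α j` is the part of `x j` coming from the
event that only switch `j` is on. For the inclusion of the projection in `H`, let each `β j` be the
larger candidate, so that `M` is still one of the four given matrices. The perspective bound makes
`(α j, β j)` realizable where only switch `j` is on; the affine bound gives the remainder `(x - α, X
- Diag β)` a diagonal at most `x - α`. That remainder lives over `y = (1, 1)`, where positive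
semidefiniteness and McCormick suffice (`pt_mem_H_of_unitSquare`): changing diagonal entries reduces
to covariance of rank at most one, which two points of the square realize (`exists_pos_chord`).
Conversely, each generator lifts to a feasible point, and the feasible set is convex because each
candidate is convex and `M` decreases in `β`. -/

namespace SwitchHull

/-! ### Coordinates on the space of points -/

/-- The point with symmetric matrix part given by its real coordinates. -/
def pt (x₁ x₂ p c q y₁ y₂ Y : ℝ) : Point := (![x₁, x₂], !![p, c; c, q], ![y₁, y₂], Y)

lemma pt_add (x₁ x₂ p c q y₁ y₂ Y x₁' x₂' p' c' q' y₁' y₂' Y' : ℝ) :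
    pt x₁ x₂ p c q y₁ y₂ Y + pt x₁' x₂' p' c' q' y₁' y₂' Y' =
      pt (x₁ + x₁') (x₂ + x₂') (p + p') (c + c') (q + q') (y₁ + y₁') (y₂ + y₂') (Y + Y') := by
  simp [pt]

lemma smul_pt (r x₁ x₂ p c q y₁ y₂ Y : ℝ) :
    r • pt x₁ x₂ p c q y₁ y₂ Y =
      pt (r * x₁) (r * x₂) (r * p) (r * c) (r * q) (r * y₁) (r * y₂) (r * Y) := by
  simp [pt]

lemma eq_pt {x : Fin 2 → ℝ} {X : Matrix (Fin 2) (Fin 2) ℝ} {y : Fin 2 → ℝ} {Y : ℝ}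
    (hX : X.IsSymm) :
    ((x, X, y, Y) : Point) = pt (x 0) (x 1) (X 0 0) (X 0 1) (X 1 1) (y 0) (y 1) Y := by
  have h : X 1 0 = X 0 1 := hX.apply 0 1
  refine Prod.ext ?_ (Prod.ext ?_ (Prod.ext ?_ rfl))
  · ext i; fin_cases i <;> rfl
  · ext i j; fin_cases i <;> fin_cases j <;> simp [pt, h]
  · ext i; fin_cases i <;> rfl

lemma convex_H : Convex ℝ H := convex_convexHull ℝ _

lemma pt_generator_mem_H {x₁ x₂ y₁ y₂ : ℝ} (h₁ : 0 ≤ x₁) (h₂ : 0 ≤ x₂) (h₁' : x₁ ≤ y₁)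
    (h₂' : x₂ ≤ y₂) (hy₁ : y₁ = 0 ∨ y₁ = 1) (hy₂ : y₂ = 0 ∨ y₂ = 1) :
    pt x₁ x₂ (x₁ ^ 2) (x₁ * x₂) (x₂ ^ 2) y₁ y₂ (y₁ * y₂) ∈ H := by
  refine subset_convexHull ℝ _ ⟨![x₁, x₂], ![y₁, y₂], ?_, ?_, ?_, ?_⟩
  · intro i; fin_cases i <;> simpa
  · intro i; fin_cases i <;> simpa
  · intro i; fin_cases i <;> simpa
  · refine Prod.ext rfl (Prod.ext ?_ rfl)
    ext i j
    fin_cases i <;> fin_cases j <;> simp [pt, Matrix.vecMulVec_apply, sq, mul_comm]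

lemma pt_zero : pt 0 0 0 0 0 0 0 0 = 0 := by
  refine Prod.ext ?_ (Prod.ext ?_ (Prod.ext ?_ rfl))
  · ext i; fin_cases i <;> rfl
  · apply Matrix.ext
    intro i j
    fin_cases i <;> fin_cases j <;> rfl
  · ext i; fin_cases i <;> rfl

lemma zero_mem_H : (0 : Point) ∈ H := by
  simpa [pt_zero] using pt_generator_mem_H (x₁ := 0) (x₂ := 0) (y₁ := 0) (y₂ := 0)
    le_rfl le_rfl le_rfl le_rfl (Or.inl rfl) (Or.inl rfl)

lemma pt_mem_H_of_mem_Icc_left {x₁ x₂ p p₀ p₁ c q y₁ y₂ Y : ℝ}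
    (h₀ : pt x₁ x₂ p₀ c q y₁ y₂ Y ∈ H) (h₁ : pt x₁ x₂ p₁ c q y₁ y₂ Y ∈ H)
    (hp : p ∈ Set.Icc p₀ p₁) : pt x₁ x₂ p c q y₁ y₂ Y ∈ H := by
  have hc : Convex ℝ {r : ℝ | pt x₁ x₂ r c q y₁ y₂ Y ∈ H} := by
    intro r hr s hs a b ha hb hab
    have := convex_H hr hs ha hb hab
    simp only [smul_pt, pt_add, ← add_mul, hab, one_mul] at this
    exact this
  exact hc.ordConnected.out h₀ h₁ hp

lemma pt_mem_H_of_mem_Icc_right {x₁ x₂ p c q q₀ q₁ y₁ y₂ Y : ℝ}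
    (h₀ : pt x₁ x₂ p c q₀ y₁ y₂ Y ∈ H) (h₁ : pt x₁ x₂ p c q₁ y₁ y₂ Y ∈ H)
    (hq : q ∈ Set.Icc q₀ q₁) : pt x₁ x₂ p c q y₁ y₂ Y ∈ H := by
  have hc : Convex ℝ {r : ℝ | pt x₁ x₂ p c r y₁ y₂ Y ∈ H} := by
    intro r hr s hs a b ha hb hab
    have := convex_H hr hs ha hb hab
    simp only [smul_pt, pt_add, ← add_mul, hab, one_mul] at this
    exact this
  exact hc.ordConnected.out h₀ h₁ hq

/-! ### The face `y = (1, 1)`: quadratic forms on the unit square -/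

/-- If `lᵢ lⱼ + mᵢ mⱼ ≥ 0` for all `i, j`, then the segment of the line `s ↦ l + s m` inside the
nonnegative orthant contains `-r` and `r⁻¹` for some `r > 0`. -/
lemma exists_pos_chord {ι : Type*} [Finite ι] {l m : ι → ℝ} (hl : ∀ i, 0 ≤ l i)
    (hlm : ∀ i j, 0 ≤ l i * l j + m i * m j) (h0 : ∀ i, l i = 0 → m i = 0)
    (hneg : ∃ i, m i < 0) :
    ∃ r : ℝ, 0 < r ∧ ∀ i, 0 ≤ l i - r * m i ∧ 0 ≤ l i + r⁻¹ * m i := by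
  obtain ⟨k, hk⟩ := hneg
  have : Nonempty ι := ⟨k⟩
  -- The least `r` allowed by all bounds `0 ≤ l j + r⁻¹ * m j`; as one of them is tight at `i`, the
  -- other bounds become the product inequalities.
  obtain ⟨i, hi⟩ := Finite.exists_max fun i => -m i / l i
  have hpos : ∀ j, m j < 0 → 0 < l j := fun j hj =>
    lt_of_le_of_ne (hl j) fun h => hj.ne (h0 j h.symm)
  have hr : 0 < -m i / l i := lt_of_lt_of_le (div_pos (neg_pos.2 hk) (hpos k hk)) (hi k)
  have hli : 0 < l i := lt_of_le_of_ne (hl i) fun h => by simp [← h] at hr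
  refine ⟨-m i / l i, hr, fun j => ⟨?_, ?_⟩⟩
  · have : l j - -m i / l i * m j = (l i * l j + m i * m j) / l i := by
      field_simp
      ring
    rw [this]
    exact div_nonneg (hlm i j) hli.le
  · have h1 : -m j ≤ -m i / l i * l j := by
      rcases (hl j).eq_or_lt with h | h
      · simp [h0 j h.symm, ← h]
      · exact (div_le_iff₀ h).1 (hi j)
    have h2 : (-m i / l i)⁻¹ * (-m j) ≤ l j := by
      rw [inv_mul_le_iff₀ hr]
      exact h1
    linarith

/-- With `w = (u, v)` the covariance is `w wᵀ`. The points `x - r w` and `x + r⁻¹ w`, with weights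
proportional to `1` and `r²`, have mean `x` and this covariance; it remains to choose `r` keeping
both in the square. -/
lemma pt_mem_H_of_rankTwo {x₁ x₂ u v c : ℝ} (hp : x₁ ^ 2 + u ^ 2 ≤ x₁) (hq : x₂ ^ 2 + v ^ 2 ≤ x₂)
    (hc : c = x₁ * x₂ + u * v) (hc0 : 0 ≤ c) (hc1 : x₁ + x₂ - 1 ≤ c) (hcx₁ : c ≤ x₁)
    (hcx₂ : c ≤ x₂) : pt x₁ x₂ (x₁ ^ 2 + u ^ 2) c (x₂ ^ 2 + v ^ 2) 1 1 1 ∈ H := by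
  have hx₁ : x₁ ≤ 1 := by nlinarith [sq_nonneg u]
  have hx₂ : x₂ ≤ 1 := by nlinarith [sq_nonneg v]
  have hx₁' : 0 ≤ x₁ := hc0.trans hcx₁
  have hx₂' : 0 ≤ x₂ := hc0.trans hcx₂
  have gen : ∀ {a b : ℝ}, 0 ≤ a → 0 ≤ b → a ≤ 1 → b ≤ 1 →
      pt a b (a ^ 2) (a * b) (b ^ 2) 1 1 1 ∈ H := fun ha hb ha' hb' => by
    simpa using pt_generator_mem_H ha hb ha' hb' (Or.inr rfl) (Or.inr rfl)
  by_cases h : u = 0 ∧ v = 0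
  · obtain ⟨rfl, rfl⟩ := h
    simpa [hc] using gen hx₁' hx₂' hx₁ hx₂
  -- `l` lists the slacks of the four sides of the square and `m` their slopes along `w`. The
  -- pairwise product conditions follow from McCormick and the diagonal bounds.
  obtain ⟨r, hr, hrr⟩ := exists_pos_chord (l := ![x₁, x₂, 1 - x₁, 1 - x₂]) (m := ![u, v, -u, -v])
    (by intro i; fin_cases i <;> simpa)
    (by
      intro i j
      fin_cases i <;> fin_cases j <;> simp <;> nlinarith [sq_nonneg u, sq_nonneg v])
    (by
      intro i
      fin_cases i <;> simp <;> intro h <;> apply pow_eq_zero_iff (two_ne_zero) |>.1 <;>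
        nlinarith [sq_nonneg u, sq_nonneg v])
    (by
      by_contra! hh
      have a0 := hh 0
      have a1 := hh 1
      have a2 := hh 2
      have a3 := hh 3
      simp at a0 a1 a2 a3
      exact h ⟨le_antisymm a2 a0, le_antisymm a3 a1⟩)
  have a0 := hrr 0
  have a1 := hrr 1
  have a2 := hrr 2
  have a3 := hrr 3
  simp at a0 a1 a2 a3
  have g1 := gen (a := x₁ - r * u) (b := x₂ - r * v) (by linarith) (by linarith) (by linarith)
    (by linarith)
  have g2 := gen (a := x₁ + r⁻¹ * u) (b := x₂ + r⁻¹ * v) (by linarith) (by linarith) (by linarith)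
    (by linarith)
  have hr2 : 0 < 1 + r ^ 2 := by positivity
  have := convex_H g1 g2 (a := 1 / (1 + r ^ 2)) (b := r ^ 2 / (1 + r ^ 2)) (by positivity)
    (by positivity) (by field_simp)
  rw [smul_pt, smul_pt, pt_add] at this
  convert this using 1
  congr 1 <;> subst_vars <;> field_simp <;> ring

lemma pt_mem_H_of_det_eq_zero {x₁ x₂ p c q : ℝ} (hp₀ : x₁ ^ 2 ≤ p) (hq₀ : x₂ ^ 2 ≤ q)
    (hp : p ≤ x₁) (hq : q ≤ x₂) (hdet : (p - x₁ ^ 2) * (q - x₂ ^ 2) = (c - x₁ * x₂) ^ 2)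
    (hc0 : 0 ≤ c) (hc1 : x₁ + x₂ - 1 ≤ c) (hcx₁ : c ≤ x₁) (hcx₂ : c ≤ x₂) :
    pt x₁ x₂ p c q 1 1 1 ∈ H := by
  obtain ⟨u, v, hu, hv, huv⟩ :
      ∃ u v : ℝ, u ^ 2 = p - x₁ ^ 2 ∧ v ^ 2 = q - x₂ ^ 2 ∧ u * v = c - x₁ * x₂ := by
    have hs₁ := Real.sq_sqrt (sub_nonneg.2 hp₀)
    have hs₂ := Real.sq_sqrt (sub_nonneg.2 hq₀)
    have : √(p - x₁ ^ 2) * √(q - x₂ ^ 2) = |c - x₁ * x₂| := by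
      rw [← Real.sqrt_mul (sub_nonneg.2 hp₀), hdet, Real.sqrt_sq_eq_abs]
    rcases abs_choice (c - x₁ * x₂) with h | h
    · exact ⟨_, _, hs₁, hs₂, this.trans h⟩
    · exact ⟨_, -√(q - x₂ ^ 2), hs₁, by rw [neg_sq, hs₂], by rw [mul_neg, this, h, neg_neg]⟩
  have hp' : p = x₁ ^ 2 + u ^ 2 := by linarith
  have hq' : q = x₂ ^ 2 + v ^ 2 := by linarith
  rw [hp', hq']
  exact pt_mem_H_of_rankTwo (hp' ▸ hp) (hq' ▸ hq) (by linarith) hc0 hc1 hcx₁ hcx₂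

lemma pt_mem_H_of_diag_eq {x₁ x₂ c : ℝ} (hc0 : 0 ≤ c) (hc1 : x₁ + x₂ - 1 ≤ c) (hcx₁ : c ≤ x₁)
    (hcx₂ : c ≤ x₂) : pt x₁ x₂ x₁ c x₂ 1 1 1 ∈ H := by
  have gen : ∀ {a b : ℝ}, 0 ≤ a → 0 ≤ b → a ≤ 1 → b ≤ 1 →
      pt a b (a ^ 2) (a * b) (b ^ 2) 1 1 1 ∈ H := fun ha hb ha' hb' => by
    simpa using pt_generator_mem_H ha hb ha' hb' (Or.inr rfl) (Or.inr rfl)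
  -- The weights are the joint distribution of two Bernoulli variables with means `x₁`, `x₂` and
  -- mixed moment `c`.
  have key := convex_H.sum_mem (t := Finset.univ)
    (w := ![c, x₁ - c, x₂ - c, 1 - x₁ - x₂ + c])
    (z := ![pt 1 1 (1 ^ 2) (1 * 1) (1 ^ 2) 1 1 1, pt 1 0 (1 ^ 2) (1 * 0) (0 ^ 2) 1 1 1,
      pt 0 1 (0 ^ 2) (0 * 1) (1 ^ 2) 1 1 1, pt 0 0 (0 ^ 2) (0 * 0) (0 ^ 2) 1 1 1])
    (by intro i _; fin_cases i <;> simp <;> linarith)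
    (by simp only [Fin.sum_univ_four, Matrix.cons_val]; ring)
    (by intro i _; fin_cases i <;> apply gen <;> norm_num)
  simp only [Fin.sum_univ_four, Matrix.cons_val, smul_pt, pt_add] at key
  convert key using 1
  congr 1 <;> ring

/-- The McCormick inequalities and positive semidefiniteness describe the convex hull of the
points `(x, x xᵀ)` with `x` in the unit square. -/
lemma pt_mem_H_of_unitSquare {x₁ x₂ p c q : ℝ} (hp₀ : x₁ ^ 2 ≤ p) (hq₀ : x₂ ^ 2 ≤ q)
    (hp : p ≤ x₁) (hq : q ≤ x₂) (hdet : (c - x₁ * x₂) ^ 2 ≤ (p - x₁ ^ 2) * (q - x₂ ^ 2))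
    (hc0 : 0 ≤ c) (hc1 : x₁ + x₂ - 1 ≤ c) (hcx₁ : c ≤ x₁) (hcx₂ : c ≤ x₂) :
    pt x₁ x₂ p c q 1 1 1 ∈ H := by
  -- First settle the largest `p`, namely `x₁`, by interpolating `q` between its zero-determinant
  -- value and `x₂`. Then `p` is interpolated in the same way.
  have hx₁q : pt x₁ x₂ x₁ c q 1 1 1 ∈ H := by
    have hdet' : (c - x₁ * x₂) ^ 2 ≤ (x₁ - x₁ ^ 2) * (q - x₂ ^ 2) :=
      hdet.trans (mul_le_mul_of_nonneg_right (by linarith) (by linarith))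
    rcases (hp₀.trans hp).eq_or_lt with h | h
    · refine pt_mem_H_of_det_eq_zero h.le hq₀ le_rfl hq ?_ hc0 hc1 hcx₁ hcx₂
      rw [h, sub_self, zero_mul] at hdet' ⊢
      exact le_antisymm (sq_nonneg _) hdet'
    · have h' : 0 < x₁ - x₁ ^ 2 := sub_pos.2 h
      have hle : x₂ ^ 2 + (c - x₁ * x₂) ^ 2 / (x₁ - x₁ ^ 2) ≤ q := by
        have := (div_le_iff₀' h').2 hdet'
        linarith
      refine pt_mem_H_of_mem_Icc_right (pt_mem_H_of_det_eq_zero h.le ?_ le_rfl (hle.trans hq) ?_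
        hc0 hc1 hcx₁ hcx₂) (pt_mem_H_of_diag_eq hc0 hc1 hcx₁ hcx₂) ⟨hle, hq⟩
      · have : 0 ≤ (c - x₁ * x₂) ^ 2 / (x₁ - x₁ ^ 2) := by positivity
        linarith
      · rw [add_sub_cancel_left, mul_div_cancel₀ _ h'.ne']
  rcases hq₀.eq_or_lt with h | h
  · refine pt_mem_H_of_det_eq_zero hp₀ hq₀ hp hq ?_ hc0 hc1 hcx₁ hcx₂
    rw [h, sub_self, mul_zero] at hdet ⊢
    exact le_antisymm (sq_nonneg _) hdet
  · have h' : 0 < q - x₂ ^ 2 := sub_pos.2 h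
    have hle : x₁ ^ 2 + (c - x₁ * x₂) ^ 2 / (q - x₂ ^ 2) ≤ p := by
      have := (div_le_iff₀ h').2 hdet
      linarith
    refine pt_mem_H_of_mem_Icc_left (pt_mem_H_of_det_eq_zero ?_ hq₀ (hle.trans hp) hq ?_
      hc0 hc1 hcx₁ hcx₂) hx₁q ⟨hle, hp⟩
    · have : 0 ≤ (c - x₁ * x₂) ^ 2 / (q - x₂ ^ 2) := by positivity
      linarith
    · rw [add_sub_cancel_left, div_mul_cancel₀ _ h'.ne']

/-! ### Homogenization -/

/-- The scaled version of `pt_mem_H_of_unitSquare`. -/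
lemma exists_smul_eq_of_quadratic_nonneg {t x₁ x₂ p c q : ℝ} (ht : 0 ≤ t)
    (hpsd : ∀ a b d : ℝ, 0 ≤ t * a ^ 2 + 2 * x₁ * a * b + 2 * x₂ * a * d + p * b ^ 2 +
      2 * c * b * d + q * d ^ 2)
    (hp : p ≤ x₁) (hq : q ≤ x₂) (hc0 : 0 ≤ c) (hc1 : x₁ + x₂ - t ≤ c) (hcx₁ : c ≤ x₁)
    (hcx₂ : c ≤ x₂) : ∃ P ∈ H, t • P = pt x₁ x₂ p c q t t t := by
  rcases ht.eq_or_lt with rfl | ht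
  · have hp0 := hpsd 0 1 0
    have hq0 := hpsd 0 0 1
    have e1 : x₁ = 0 := by linarith
    have e2 : x₂ = 0 := by linarith
    subst e1 e2
    have e3 : p = 0 := by linarith
    have e4 : q = 0 := by linarith
    have e5 : c = 0 := by linarith
    subst e3 e4 e5
    exact ⟨0, zero_mem_H, by rw [smul_zero, pt_zero]⟩
  refine ⟨pt (x₁ / t) (x₂ / t) (p / t) (c / t) (q / t) 1 1 1, ?_, ?_⟩
  · have form : ∀ b d : ℝ, 0 ≤ (p / t - (x₁ / t) ^ 2) * b ^ 2 +
        2 * (c / t - x₁ / t * (x₂ / t)) * b * d + (q / t - (x₂ / t) ^ 2) * d ^ 2 := by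
      intro b d
      -- Minimizing over the first variable leaves the Schur complement.
      have := div_nonneg (hpsd (-(x₁ * b + x₂ * d) / t) b d) ht.le
      refine this.trans_eq ?_
      field_simp
      ring
    have hg₁ := form 1 0
    have hg₂ := form 0 1
    have hdisc := discrim_le_zero (a := p / t - (x₁ / t) ^ 2)
      (b := 2 * (c / t - x₁ / t * (x₂ / t))) (c := q / t - (x₂ / t) ^ 2)
      fun b => by have := form b 1; linarith
    unfold discrim at hdisc
    apply pt_mem_H_of_unitSquare
    · linarith
    · linarith
    · gcongr
    · gcongr
    · linarith
    · positivity
    · rw [← add_div, ← div_self ht.ne', ← sub_div]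
      gcongr
    · gcongr
    · gcongr
  · rw [smul_pt]
    congr 1 <;> simp [mul_div_cancel₀ _ ht.ne']

/-- Over `y = (1, 0)`, after division by `t`, the point `(a, b)` lies between the parabola `s ↦ s²`
and its chord on `[0, 1]`. If `t = 0`, everything vanishes. -/
lemma exists_smul_eq_of_first {t a b : ℝ} (ha : 0 ≤ a) (hat : a ≤ t) (hb : t⁻¹ * a ^ 2 ≤ b)
    (hba : b ≤ a) : ∃ P ∈ H, t • P = pt a 0 b 0 0 t 0 0 := by
  rcases (ha.trans hat).eq_or_lt with rfl | ht
  · have e1 : a = 0 := le_antisymm hat ha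
    subst e1
    have e2 : b = 0 := le_antisymm hba (by simpa using hb)
    subst e2
    exact ⟨0, zero_mem_H, by rw [smul_zero, pt_zero]⟩
  have gen : ∀ {s : ℝ}, 0 ≤ s → s ≤ 1 → pt s 0 (s ^ 2) 0 0 1 0 0 ∈ H := fun hs hs' => by
    simpa using pt_generator_mem_H hs le_rfl hs' le_rfl (Or.inr rfl) (Or.inl rfl)
  have h0 : 0 ≤ a / t := by positivity
  have h1 : a / t ≤ 1 := (div_le_one ht).2 hat
  refine ⟨pt (a / t) 0 (b / t) 0 0 1 0 0, pt_mem_H_of_mem_Icc_left (gen h0 h1)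
    (p₁ := a / t) ?_ ⟨?_, by gcongr⟩, ?_⟩
  · have := convex_H (gen zero_le_one le_rfl) (gen le_rfl zero_le_one) h0 (sub_nonneg.2 h1)
      (by ring)
    rw [smul_pt, smul_pt, pt_add] at this
    simpa using this
  · have : (a / t) ^ 2 = t⁻¹ * a ^ 2 / t := by field_simp
    rw [this]
    gcongr
  · rw [smul_pt]
    congr 1 <;> simp [mul_div_cancel₀ _ ht.ne']

lemma exists_smul_eq_of_second {t a b : ℝ} (ha : 0 ≤ a) (hat : a ≤ t) (hb : t⁻¹ * a ^ 2 ≤ b)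
    (hba : b ≤ a) : ∃ P ∈ H, t • P = pt 0 a 0 0 b 0 t 0 := by
  rcases (ha.trans hat).eq_or_lt with rfl | ht
  · have e1 : a = 0 := le_antisymm hat ha
    subst e1
    have e2 : b = 0 := le_antisymm hba (by simpa using hb)
    subst e2
    exact ⟨0, zero_mem_H, by rw [smul_zero, pt_zero]⟩
  have gen : ∀ {s : ℝ}, 0 ≤ s → s ≤ 1 → pt 0 s 0 0 (s ^ 2) 0 1 0 ∈ H := fun hs hs' => by
    simpa using pt_generator_mem_H le_rfl hs le_rfl hs' (Or.inl rfl) (Or.inr rfl)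
  have h0 : 0 ≤ a / t := by positivity
  have h1 : a / t ≤ 1 := (div_le_one ht).2 hat
  refine ⟨pt 0 (a / t) 0 0 (b / t) 0 1 0, pt_mem_H_of_mem_Icc_right (gen h0 h1)
    (q₁ := a / t) ?_ ⟨?_, by gcongr⟩, ?_⟩
  · have := convex_H (gen zero_le_one le_rfl) (gen le_rfl zero_le_one) h0 (sub_nonneg.2 h1)
      (by ring)
    rw [smul_pt, smul_pt, pt_add] at this
    simpa using this
  · have : (a / t) ^ 2 = t⁻¹ * a ^ 2 / t := by field_simp
    rw [this]
    gcongr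
  · rw [smul_pt]
    congr 1 <;> simp [mul_div_cancel₀ _ ht.ne']

/-! ### Membership in the constraint sets -/

lemma mem_linearSet {x : Fin 2 → ℝ} {X : Matrix (Fin 2) (Fin 2) ℝ} {y : Fin 2 → ℝ} {Y : ℝ}
    {α : Fin 2 → ℝ} : (((x, X, y, Y), α) : Lifted) ∈ linearSet ↔
      X.IsSymm ∧ (X 0 0 ≤ x 0 ∧ X 1 1 ≤ x 1 ∧ x 0 ≤ y 0 ∧ x 1 ≤ y 1) ∧
      (0 ≤ X 0 1 ∧ x 0 - α 0 + (x 1 - α 1) - Y ≤ X 0 1 ∧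
        X 0 1 ≤ x 0 - α 0 ∧ X 0 1 ≤ x 1 - α 1) ∧
      (0 ≤ α 0 ∧ α 0 ≤ y 0 - Y ∧ 0 ≤ α 1 ∧ α 1 ≤ y 1 - Y) ∧
      (0 ≤ Y ∧ y 0 + y 1 - 1 ≤ Y ∧ Y ≤ y 0 ∧ Y ≤ y 1) := by
  constructor
  · rintro ⟨x', X', y', Y', α', h, h1, h2, h3, h4, h5⟩
    cases h
    simp only [Pi.le_def, Fin.forall_fin_two, Matrix.diag_apply, max_le_iff, le_min_iff, RLTy,
      Set.mem_ofPred_eq] at h2 h3 h4 h5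
    tauto
  · intro h
    refine ⟨x, X, y, Y, α, rfl, ?_⟩
    simp only [Pi.le_def, Fin.forall_fin_two, Matrix.diag_apply, max_le_iff, le_min_iff, RLTy,
      Set.mem_ofPred_eq]
    tauto

lemma posSemidef_M_iff {x : Fin 2 → ℝ} {X : Matrix (Fin 2) (Fin 2) ℝ} {Y : ℝ}
    {α β : Fin 2 → ℝ} (hX : X.IsSymm) : (M x X Y α β).PosSemidef ↔
      ∀ a b d : ℝ, 0 ≤ Y * a ^ 2 + 2 * (x 0 - α 0) * a * b + 2 * (x 1 - α 1) * a * d +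
        (X 0 0 - β 0) * b ^ 2 + 2 * X 0 1 * b * d + (X 1 1 - β 1) * d ^ 2 := by
  have hs : X 1 0 = X 0 1 := hX.apply 0 1
  have form : ∀ z : Fin 3 → ℝ, star z ⬝ᵥ (M x X Y α β).mulVec z =
      Y * z 0 ^ 2 + 2 * (x 0 - α 0) * z 0 * z 1 + 2 * (x 1 - α 1) * z 0 * z 2 +
        (X 0 0 - β 0) * z 1 ^ 2 + 2 * X 0 1 * z 1 * z 2 + (X 1 1 - β 1) * z 2 ^ 2 := by
    intro z
    simp [M, Matrix.mulVec, dotProduct, Fin.sum_univ_three, hs]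
    ring
  rw [Matrix.posSemidef_iff_dotProduct_mulVec]
  constructor
  · intro h a b d
    have := h.2 ![a, b, d]
    rw [form] at this
    simpa using this
  · intro h
    refine ⟨?_, fun z => by rw [form]; exact h _ _ _⟩
    ext i j
    fin_cases i <;> fin_cases j <;> simp [M, hs]

lemma mem_psdSet {p q : Fin 2} {x : Fin 2 → ℝ} {X : Matrix (Fin 2) (Fin 2) ℝ} {y : Fin 2 → ℝ}
    {Y : ℝ} {α : Fin 2 → ℝ} : (((x, X, y, Y), α) : Lifted) ∈ psdSet p q ↔
      (M x X Y α (betaPQ p q x X y Y α)).PosSemidef := by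
  constructor
  · rintro ⟨x', X', y', Y', α', h, h1⟩
    cases h
    exact h1
  · exact fun h => ⟨x, X, y, Y, α, rfl, h⟩

/-! ### The convex hull contains the projection -/

lemma mem_H_of_mem_feasibleSet {v : Lifted} (hv : v ∈ feasibleSet) : v.1 ∈ H := by
  obtain ⟨⟨x, X, y, Y⟩, α⟩ := v
  obtain ⟨hlin, hpsd⟩ := hv
  obtain ⟨hX, ⟨hd0, hd1, -, -⟩, ⟨hc0, hc1, hcx0, hcx1⟩, ⟨ha0, ha0', ha1, ha1'⟩,
    hY0, hY1, hY2, hY3⟩ := mem_linearSet.1 hlin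
  have persp : ∀ j, 0 ≤ α j → α j ≤ y j - Y → perspectivePiece y Y α j ≤ α j := by
    intro j h0 h1
    rcases h0.eq_or_lt with h | h
    · simp [perspectivePiece, ← h]
    · rw [perspectivePiece, inv_mul_le_iff₀ (h.trans_le h1)]
      nlinarith
  set b₀ := max (affinePiece x X α 0) (perspectivePiece y Y α 0) with hb₀
  set b₁ := max (affinePiece x X α 1) (perspectivePiece y Y α 1) with hb₁
  have hb₀α : b₀ ≤ α 0 := max_le (by unfold affinePiece; linarith) (persp 0 ha0 ha0')
  have hb₁α : b₁ ≤ α 1 := max_le (by unfold affinePiece; linarith) (persp 1 ha1 ha1')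
  have hM : (M x X Y α ![b₀, b₁]).PosSemidef := by
    obtain ⟨p, hp⟩ : ∃ p : Fin 2, b₀ =
        if p = 0 then affinePiece x X α 0 else perspectivePiece y Y α 0 := by
      rcases max_choice (affinePiece x X α 0) (perspectivePiece y Y α 0) with h | h
      · exact ⟨0, h⟩
      · exact ⟨1, h⟩
    obtain ⟨q, hq⟩ : ∃ q : Fin 2, b₁ =
        if q = 0 then affinePiece x X α 1 else perspectivePiece y Y α 1 := by
      rcases max_choice (affinePiece x X α 1) (perspectivePiece y Y α 1) with h | h
      · exact ⟨0, h⟩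
      · exact ⟨1, h⟩
    rw [hp, hq]
    exact mem_psdSet.1 (hpsd p q)
  have haff₀ : affinePiece x X α 0 ≤ b₀ := le_max_left _ _
  have haff₁ : affinePiece x X α 1 ≤ b₁ := le_max_left _ _
  unfold affinePiece at haff₀ haff₁
  obtain ⟨P, hP, hP'⟩ := exists_smul_eq_of_quadratic_nonneg hY0 ((posSemidef_M_iff hX).1 hM)
    (by simp; linarith) (by simp; linarith) hc0 hc1 hcx0 hcx1
  obtain ⟨Q, hQ, hQ'⟩ := exists_smul_eq_of_first ha0 ha0'
    (le_max_right (affinePiece x X α 0) (perspectivePiece y Y α 0)) hb₀α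
  obtain ⟨R, hR, hR'⟩ := exists_smul_eq_of_second ha1 ha1'
    (le_max_right (affinePiece x X α 1) (perspectivePiece y Y α 1)) hb₁α
  -- The weights are the masses of `y = (1, 1), (1, 0), (0, 1), (0, 0)`.
  have key := convex_H.sum_mem (t := Finset.univ) (w := ![Y, y 0 - Y, y 1 - Y, 1 - y 0 - y 1 + Y])
    (z := ![P, Q, R, 0])
    (by intro i _; fin_cases i <;> simp <;> linarith)
    (by simp only [Fin.sum_univ_four, Matrix.cons_val]; ring)
    (by intro i _; fin_cases i <;> simp [hP, hQ, hR, zero_mem_H])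
  simp only [Fin.sum_univ_four, Matrix.cons_val, hP', hQ', hR', smul_zero, pt_add, add_zero]
    at key
  rw [eq_pt hX]
  convert key using 1
  simp [← hb₀, ← hb₁]

/-! ### Convexity of the constraint sets -/

lemma convex_linearSet : Convex ℝ linearSet := by
  rintro ⟨⟨x, X, y, Y⟩, α⟩ h ⟨⟨x', X', y', Y'⟩, α'⟩ h' a b ha hb hab
  obtain ⟨hX, h⟩ := mem_linearSet.1 h
  obtain ⟨hX', h'⟩ := mem_linearSet.1 h'
  change (((a • x + b • x', a • X + b • X', a • y + b • y', a * Y + b * Y'),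
    a • α + b • α') : Lifted) ∈ linearSet
  refine mem_linearSet.2 ⟨(hX.smul a).add (hX'.smul b), ?_⟩
  obtain ⟨⟨k1, k2, k3, k4⟩, ⟨k5, k6, k7, k8⟩, ⟨k9, k10, k11, k12⟩, k13, k14, k15, k16⟩ := h
  obtain ⟨⟨l1, l2, l3, l4⟩, ⟨l5, l6, l7, l8⟩, ⟨l9, l10, l11, l12⟩, l13, l14, l15, l16⟩ := h'
  have comb : ∀ {r s r' s' : ℝ}, r ≤ s → r' ≤ s' → a * r + b * r' ≤ a * s + b * s' :=
    fun h h' => add_le_add (mul_le_mul_of_nonneg_left h ha) (mul_le_mul_of_nonneg_left h' hb)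
  simp only [Matrix.add_apply, Matrix.smul_apply, Pi.add_apply, Pi.smul_apply, smul_eq_mul]
  refine ⟨⟨?_, ?_, ?_, ?_⟩, ⟨?_, ?_, ?_, ?_⟩, ⟨?_, ?_, ?_, ?_⟩, ?_, ?_, ?_, ?_⟩
  · linarith [comb k1 l1]
  · linarith [comb k2 l2]
  · linarith [comb k3 l3]
  · linarith [comb k4 l4]
  · linarith [comb k5 l5]
  · linarith [comb k6 l6]
  · linarith [comb k7 l7]
  · linarith [comb k8 l8]
  · linarith [comb k9 l9]
  · linarith [comb k10 l10]
  · linarith [comb k11 l11]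
  · linarith [comb k12 l12]
  · linarith [comb k13 l13]
  · linarith [comb k14 l14]
  · linarith [comb k15 l15]
  · linarith [comb k16 l16]

/-- Subadditivity of the perspective of the square. The convention `0⁻¹ = 0` is harmless, since `t =
0` forces `s = 0`. -/
lemma inv_mul_sq_add_le {t t' s s' : ℝ} (hs : 0 ≤ s) (hst : s ≤ t) (hs' : 0 ≤ s') (hst' : s' ≤ t') :
    (t + t')⁻¹ * (s + s') ^ 2 ≤ t⁻¹ * s ^ 2 + t'⁻¹ * s' ^ 2 := by
  rcases (hs.trans hst).eq_or_lt with rfl | ht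
  · simp [le_antisymm hst hs]
  rcases (hs'.trans hst').eq_or_lt with rfl | ht'
  · simp [le_antisymm hst' hs']
  rw [inv_mul_le_iff₀ (by positivity)]
  have : (t + t') * (t⁻¹ * s ^ 2 + t'⁻¹ * s' ^ 2) - (s + s') ^ 2 =
      (t' * s - t * s') ^ 2 / (t * t') := by
    field_simp
    ring
  have h : 0 ≤ (t' * s - t * s') ^ 2 / (t * t') := by positivity
  linarith

lemma perspectivePiece_combo_le {y y' α α' : Fin 2 → ℝ} {Y Y' a b : ℝ} (j : Fin 2)
    (ha : 0 ≤ a) (hb : 0 ≤ b) (h0 : 0 ≤ α j) (h1 : α j ≤ y j - Y) (h0' : 0 ≤ α' j)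
    (h1' : α' j ≤ y' j - Y') :
    perspectivePiece (a • y + b • y') (a * Y + b * Y') (a • α + b • α') j ≤
      a * perspectivePiece y Y α j + b * perspectivePiece y' Y' α' j := by
  have key := inv_mul_sq_add_le (mul_nonneg ha h0) (mul_le_mul_of_nonneg_left h1 ha)
    (mul_nonneg hb h0') (mul_le_mul_of_nonneg_left h1' hb)
  have scale : ∀ r t s : ℝ, (r * t)⁻¹ * (r * s) ^ 2 = r * (t⁻¹ * s ^ 2) := by
    intro r t s
    rcases eq_or_ne r 0 with rfl | hr
    · simp
    · rw [mul_inv]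
      field_simp
  rw [scale, scale] at key
  simp only [perspectivePiece, Pi.add_apply, Pi.smul_apply, smul_eq_mul]
  convert key using 3
  ring

/-- The linear constraints supply the domain on which `perspectivePiece` is convex; the slack in `β`
only adds nonnegative multiples of squares to the quadratic form. -/
lemma convex_linearSet_inter_psdSet (p q : Fin 2) : Convex ℝ (linearSet ∩ psdSet p q) := by
  rintro ⟨⟨x, X, y, Y⟩, α⟩ ⟨h, hM⟩ ⟨⟨x', X', y', Y'⟩, α'⟩ ⟨h', hM'⟩ a b ha hb hab
  refine ⟨convex_linearSet h h' ha hb hab, ?_⟩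
  obtain ⟨hX, -, -, ⟨h0, h1, h2, h3⟩, -⟩ := mem_linearSet.1 h
  obtain ⟨hX', -, -, ⟨h0', h1', h2', h3'⟩, -⟩ := mem_linearSet.1 h'
  have hM := (posSemidef_M_iff hX).1 (mem_psdSet.1 hM)
  have hM' := (posSemidef_M_iff hX').1 (mem_psdSet.1 hM')
  change (((a • x + b • x', a • X + b • X', a • y + b • y', a * Y + b * Y'),
    a • α + b • α') : Lifted) ∈ psdSet p q
  refine mem_psdSet.2 ((posSemidef_M_iff ((hX.smul a).add (hX'.smul b))).2 fun r s t => ?_)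
  have aff : ∀ j, affinePiece (a • x + b • x') (a • X + b • X') (a • α + b • α') j ≤
      a * affinePiece x X α j + b * affinePiece x' X' α' j := by
    intro j
    simp only [affinePiece, Matrix.add_apply, Matrix.smul_apply, Pi.add_apply, Pi.smul_apply,
      smul_eq_mul]
    linarith
  have b0 : betaPQ p q (a • x + b • x') (a • X + b • X') (a • y + b • y') (a * Y + b * Y')
      (a • α + b • α') 0 ≤
        a * betaPQ p q x X y Y α 0 + b * betaPQ p q x' X' y' Y' α' 0 := by
    simp only [betaPQ, Matrix.cons_val_zero]
    split_ifs
    · exact aff 0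
    · exact perspectivePiece_combo_le 0 ha hb h0 h1 h0' h1'
  have b1 : betaPQ p q (a • x + b • x') (a • X + b • X') (a • y + b • y') (a * Y + b * Y')
      (a • α + b • α') 1 ≤
        a * betaPQ p q x X y Y α 1 + b * betaPQ p q x' X' y' Y' α' 1 := by
    simp only [betaPQ, Matrix.cons_val_one, Matrix.cons_val_fin_one]
    split_ifs
    · exact aff 1
    · exact perspectivePiece_combo_le 1 ha hb h2 h3 h2' h3'
  have e := add_nonneg (mul_nonneg ha (hM r s t)) (mul_nonneg hb (hM' r s t))
  have e0 := mul_nonneg (sub_nonneg.2 b0) (sq_nonneg s)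
  have e1 := mul_nonneg (sub_nonneg.2 b1) (sq_nonneg t)
  simp only [Matrix.add_apply, Matrix.smul_apply, Pi.add_apply, Pi.smul_apply, smul_eq_mul]
    at e0 e1 ⊢
  linarith

lemma convex_feasibleSet : Convex ℝ feasibleSet := by
  intro v hv w hw a b ha hb hab
  exact ⟨convex_linearSet hv.1 hw.1 ha hb hab, fun p q =>
    (convex_linearSet_inter_psdSet p q ⟨hv.1, hv.2 p q⟩ ⟨hw.1, hw.2 p q⟩ ha hb hab).2⟩

/-! ### The projection contains the convex hull -/

lemma generator_mem_feasibleSet {x y : Fin 2 → ℝ} (hx : 0 ≤ x) (hxy : x ≤ y)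
    (hy : ∀ j, y j = 0 ∨ y j = 1) :
    (((x, Matrix.vecMulVec x x, y, y 0 * y 1), ![x 0 * (1 - y 1), x 1 * (1 - y 0)]) : Lifted) ∈
      feasibleSet := by
  have hx0 : 0 ≤ x 0 := hx 0
  have hx1 : 0 ≤ x 1 := hx 1
  have hxy0 := hxy 0
  have hxy1 := hxy 1
  have hX : (Matrix.vecMulVec x x).IsSymm := by
    ext i j
    simp [Matrix.vecMulVec_apply, mul_comm]
  constructor
  · rw [mem_linearSet]
    refine ⟨hX, ?_⟩
    simp only [Matrix.vecMulVec_apply, Matrix.cons_val_zero, Matrix.cons_val_one,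
      Matrix.cons_val_fin_one]
    rcases hy 0 with h0 | h0 <;> rcases hy 1 with h1 | h1 <;> rw [h0] at hxy0 <;>
      rw [h1] at hxy1 <;> simp only [h0, h1] <;>
      refine ⟨⟨?_, ?_, ?_, ?_⟩, ⟨?_, ?_, ?_, ?_⟩, ⟨?_, ?_, ?_, ?_⟩, ?_, ?_, ?_, ?_⟩ <;> nlinarith
  · intro p q
    rw [mem_psdSet, posSemidef_M_iff hX]
    intro a b d
    simp only [betaPQ, affinePiece, perspectivePiece, Matrix.vecMulVec_apply, Matrix.cons_val_zero,
      Matrix.cons_val_one, Matrix.cons_val_fin_one]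
    have hs0 : 0 ≤ x 0 * b ^ 2 := by positivity
    have hs1 : 0 ≤ x 1 * d ^ 2 := by positivity
    -- For `y = (1, 1)` the form is this square plus diagonal terms with coefficients `0` or `x j -
    -- x j ^ 2`; for the other `y` it vanishes.
    have hsq := sq_nonneg (a + x 0 * b + x 1 * d)
    rcases hy 0 with h0 | h0 <;> rcases hy 1 with h1 | h1 <;> rw [h0] at hxy0 <;>
      rw [h1] at hxy1 <;> simp only [h0, h1]
    · have e0 : x 0 = 0 := le_antisymm hxy0 hx0
      have e1 : x 1 = 0 := le_antisymm hxy1 hx1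
      simp [e0, e1]
    · have e0 : x 0 = 0 := le_antisymm hxy0 hx0
      split_ifs <;> simp [e0] <;> nlinarith
    · have e1 : x 1 = 0 := le_antisymm hxy1 hx1
      split_ifs <;> simp [e1] <;> nlinarith
    · split_ifs <;> norm_num <;> nlinarith

lemma H_subset_image_feasibleSet : H ⊆ Prod.fst '' feasibleSet := by
  refine convexHull_min ?_ (convex_feasibleSet.linear_image (LinearMap.fst ℝ Point (Fin 2 → ℝ)))
  rintro v ⟨x, y, hx, hxy, hy, rfl⟩
  exact ⟨_, generator_mem_feasibleSet hx hxy hy, rfl⟩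

end SwitchHull

/-- `𝓗` is the projection of the feasible set, and the constraints are convex: the linear ones
define a convex set, and so does, together with them, each of the semidefinite ones. -/
theorem theorem4p1 :
    SwitchHull.H = Prod.fst '' SwitchHull.feasibleSet ∧
      Convex ℝ SwitchHull.linearSet ∧
      ∀ p q : Fin 2, Convex ℝ (SwitchHull.linearSet ∩ SwitchHull.psdSet p q) := by
  refine ⟨SwitchHull.H_subset_image_feasibleSet.antisymm ?_, SwitchHull.convex_linearSet,
    SwitchHull.convex_linearSet_inter_psdSet⟩
  rintro _ ⟨v, hv, rfl⟩
  exact SwitchHull.mem_H_of_mem_feasibleSet hv
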